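/- Let $f:\mathbb R^d\to\mathbb R$ be bounded below and twice differentiable, and suppose that for some constants $L_f,M_f>0$ and all $x,y\in\mathbb R^d$, $\|\nabla f(x)-\nabla f(y)\|\le L_f\|x-y\|$ and $\|\nabla^2 f(x)-\nabla^2 f(y)\|\le M_f\|x-y\|$ (Euclidean norm and operator norm). Let $x_{\rm init}\in\mathbb R^d$, $L_{\rm init}>0$, $M_0>0$, $\alpha>1$, $0<\beta\le 1$ be arbitrary, and put $\theta_k=\frac{k}{k+1}$. Consider the following restarted accelerated gradient method, run without a stopping test. Start with $x_0=y_0=x_{\rm init}$, $L=L_{\rm init}$, $k=0$, $K=0$, and repeat: increase $k$ and the total iteration counter $K$ by one, and set $$x_k=y_{k-1}-\tfrac1L\nabla f(y_{k-1}),\qquad y_k=x_k+\theta_k(x_k-x_{k-1}),\qquad S_k=\sum_{i=1}^k\|x_i-x_{i-1}\|^2 .$$ If $f(x_k)>f(x_0)-\frac{L S_k}{2(k+1)}$, restart: set $(x_0,y_0)\leftarrow(x_{k-1},x_{k-1})$, $L\leftarrow\alpha L$, $k\leftarrow0$. Otherwise, if $(k+1)^5M_k^2S_k>L^2$, restart: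 set $(x_0,y_0)\leftarrow(x_k,x_k)$, $L\leftarrow\beta L$, $k\leftarrow0$. Here the averaged solution is $$\bar y_k=\sum_{i=0}^{k-1}p_{k,i}\,y_i,\qquad p_{k,i}=\frac1{Z_k}\prod_{j=i+1}^{k-1}\theta_j,\qquad Z_k=\sum_{i=0}^{k-1}\prod_{j=i+1}^{k-1}\theta_j ,$$ and, in each epoch (period between two restarts), $M_k$ is computed for $k\ge1$, starting from the input $M_0$, by one of the following two rules, fixed throughout the run: (i) $\displaystyle M_k=\max\Bigl\{M_{k-1},\ \frac{12\bigl(f(y_k)-f(x_k)-\frac12\langle\nabla f(y_k)+\nabla f(x_k),\,y_k-x_k\rangle\bigr)}{\|y_k-x_k\|^3},\ \frac{\|\nabla f(y_k)+\theta_k\nabla f(x_{k-1})-(1+\theta_k)\nabla f(x_k)\|}{\theta_k\|x_k-x_{k-1}\|^2}\Bigr\}$; (ii) the maximum of the three quantities in (i) and $\displaystyle \frac{16\bigl(Z_k^2\|\nabla f(\bar y_k)\|-Z_kL\|x_k-x_{k-1}\|\bigr)}{(k-1)(k+5)^2S_k}$; quotients of the form $0/0$ are omitted from the maxima. For $K\ge1$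 let $z_K$ be the averaged solution $\bar y_k$ at total iteration $K$ (with the value of $k\ge1$, and the iterates, of that iteration before a possible restart at its end). Then, with either rule for $M_k$, $$\lim_{K\to\infty}\ \min_{1\le i\le K}\|\nabla f(z_i)\|=0 .$$ -/

import Mathlib

noncomputable section

namespace RestartedAGD

/-- The acceleration parameter `θ_k = k / (k + 1)`. -/
def theta (k : ℕ) : ℝ := (k : ℝ) / ((k : ℝ) + 1)

/-- `Z_k = ∑_{i=0}^{k-1} ∏_{j=i+1}^{k-1} θ_j`. -/
def Z (k : ℕ) : ℝ := ∑ i ∈ Finset.range k, ∏ j ∈ Finset.Ioo i k, theta j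

/-- `p_{k,i} = (1 / Z_k) ∏_{j=i+1}^{k-1} θ_j`. -/
def weight (k i : ℕ) : ℝ := 1 / Z k * ∏ j ∈ Finset.Ioo i k, theta j

section Epoch

variable {E : Type*} [NormedAddCommGroup E] [InnerProductSpace ℝ E] [CompleteSpace E]

/-- The Hessian of `f` at `x`, as a continuous linear endomorphism: the Fréchet derivative of the
gradient map. Its norm is the operator (spectral) norm. -/
def hessian (f : E → ℝ) (x : E) : E →L[ℝ] E := fderiv ℝ (gradient f) x

/-! Within one epoch, all quantities are determined by the starting point `x₀` of the epoch and by
the value of `L`, which is constant during the epoch. -/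

/-- The pair `(x_k, y_k)` of an epoch: `x_0 = y_0 = x₀`, and
`x_{k+1} = y_k - (1 / L) ∇f(y_k)`, `y_{k+1} = x_{k+1} + θ_{k+1} (x_{k+1} - x_k)`. -/
def xy (f : E → ℝ) (x₀ : E) (L : ℝ) : ℕ → E × E
  | 0 => (x₀, x₀)
  | k + 1 =>
    let p := xy f x₀ L k
    let x' := p.2 - (1 / L) • gradient f p.2
    (x', x' + theta (k + 1) • (x' - p.1))

/-- The iterate `x_k` of an epoch. -/
def x (f : E → ℝ) (x₀ : E) (L : ℝ) (k : ℕ) : E := (xy f x₀ L k).1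

/-- The iterate `y_k` of an epoch. -/
def y (f : E → ℝ) (x₀ : E) (L : ℝ) (k : ℕ) : E := (xy f x₀ L k).2

/-- `S_k = ∑_{i=1}^k ‖x_i - x_{i-1}‖²`. -/
def S (f : E → ℝ) (x₀ : E) (L : ℝ) (k : ℕ) : ℝ :=
  ∑ i ∈ Finset.range k, ‖x f x₀ L (i + 1) - x f x₀ L i‖ ^ 2

/-- The averaged solution `ȳ_k = ∑_{i=0}^{k-1} p_{k,i} y_i`. -/
def ybar (f : E → ℝ) (x₀ : E) (L : ℝ) (k : ℕ) : E :=
  ∑ i ∈ Finset.range k, weight k i • y f x₀ L i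

/-- The two update rules for the estimate `M_k`: the basic one, with two quotients, and the one with
an additional quotient involving the gradient at `ȳ_k`. -/
inductive Rule
  | basic
  | averaged

/-- `12 (f(y_k) - f(x_k) - ½⟪∇f(y_k) + ∇f(x_k), y_k - x_k⟫) / ‖y_k - x_k‖³`. -/
def quotTrapezoid (f : E → ℝ) (x₀ : E) (L : ℝ) (k : ℕ) : ℝ :=
  12 * (f (y f x₀ L k) - f (x f x₀ L k)
      - 1 / 2 * inner ℝ (gradient f (y f x₀ L k) + gradient f (x f x₀ L k))
          (y f x₀ L k - x f x₀ L k))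
    / ‖y f x₀ L k - x f x₀ L k‖ ^ 3

/-- `‖∇f(y_k) + θ_k ∇f(x_{k-1}) - (1 + θ_k) ∇f(x_k)‖ / (θ_k ‖x_k - x_{k-1}‖²)`, for `k ≥ 1`. -/
def quotGradient (f : E → ℝ) (x₀ : E) (L : ℝ) (k : ℕ) : ℝ :=
  ‖gradient f (y f x₀ L k) + theta k • gradient f (x f x₀ L (k - 1))
      - (1 + theta k) • gradient f (x f x₀ L k)‖
    / (theta k * ‖x f x₀ L k - x f x₀ L (k - 1)‖ ^ 2)

/-- `16 (Z_k² ‖∇f(ȳ_k)‖ - Z_k L ‖x_k - x_{k-1}‖) / ((k - 1) (k + 5)² S_k)`, for `k ≥ 1`. -/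
def quotAverage (f : E → ℝ) (x₀ : E) (L : ℝ) (k : ℕ) : ℝ :=
  16 * (Z k ^ 2 * ‖gradient f (ybar f x₀ L k)‖ - Z k * L * ‖x f x₀ L k - x f x₀ L (k - 1)‖)
    / (((k : ℝ) - 1) * ((k : ℝ) + 5) ^ 2 * S f x₀ L k)

/-- The estimate `M_k` of an epoch, starting from the input `M₀`. In these quotients a vanishing
denominator only occurs together with a vanishing numerator (no movement, or `k = 1` in
`quotAverage`). Such a quotient `0 / 0` is to be left out of the maximum; in Lean it is `0`, which
has the same effect because `M₀ > 0`. -/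
def M (rule : Rule) (f : E → ℝ) (x₀ : E) (L M₀ : ℝ) : ℕ → ℝ
  | 0 => M₀
  | k + 1 =>
    let m := max (M rule f x₀ L M₀ k)
      (max (quotTrapezoid f x₀ L (k + 1)) (quotGradient f x₀ L (k + 1)))
    match rule with
    | .basic => m
    | .averaged => max m (quotAverage f x₀ L (k + 1))

/-- The state of the algorithm between two iterations: the starting point `x₀` of the current epoch,
the current `L`, and the iteration counter `k` of the current epoch. The iterates
`x_0, …, x_k, y_0, …, y_k` and the estimate `M_k` are functions of these. -/
structure State (E : Type*) where
  x₀ : E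
  L : ℝ
  k : ℕ

/-- One iteration (one pass through the main loop). With `k` the incremented counter:
if `f(x_k) > f(x_0) - L S_k / (2 (k + 1))`, restart from `x_{k-1}` with `α L`;
else if `(k + 1)⁵ M_k² S_k > L²`, restart from `x_k` with `β L`;
else continue the epoch. -/
def step (rule : Rule) (f : E → ℝ) (M₀ α β : ℝ) (s : State E) : State E :=
  let k := s.k + 1
  if f (x f s.x₀ s.L k) > f s.x₀ - s.L * S f s.x₀ s.L k / (2 * ((k : ℝ) + 1)) then
    { x₀ := x f s.x₀ s.L (k - 1), L := α * s.L, k := 0 }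
  else if ((k : ℝ) + 1) ^ 5 * M rule f s.x₀ s.L M₀ k ^ 2 * S f s.x₀ s.L k > s.L ^ 2 then
    { x₀ := x f s.x₀ s.L k, L := β * s.L, k := 0 }
  else
    { x₀ := s.x₀, L := s.L, k := k }

/-- The state after `K` iterations in total, starting from `x₀ = xinit`, `L = Linit`, `k = 0`. -/
def state (rule : Rule) (f : E → ℝ) (xinit : E) (Linit M₀ α β : ℝ) : ℕ → State E
  | 0 => { x₀ := xinit, L := Linit, k := 0 }
  | K + 1 => step rule f M₀ α β (state rule f xinit Linit M₀ α β K)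

/-- `z_K`, for `K ≥ 1`: the averaged solution `ȳ_k` at total iteration `K`, where `k` is the counter
as incremented in that iteration (and before a possible reset at the end of it). -/
def z (rule : Rule) (f : E → ℝ) (xinit : E) (Linit M₀ α β : ℝ) (K : ℕ) : E :=
  let s := state rule f xinit Linit M₀ α β (K - 1)
  ybar f s.x₀ s.L (s.k + 1)

end Epoch

end RestartedAGD

end

/-! Suppose all outputs have gradient norm at least `ε`. Since `ȳ_1 = x_0`, this covers every epoch
start, so `S_k ≥ S_1 ≥ ε²/L²`. Together with `M_k ≥ M₀`, the only fact about `M_k` needed (so both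
rules are treated alike), an epoch surviving the second test at `k` has `(k+1)⁵(M₀ε)² ≤ L⁴`. For `L`
above a threshold this gives `(k+1)C ≤ L`, and an energy argument then rules out restarts that
increase `L`. Hence `L ≤ B`, epoch lengths are bounded, and each `β`-restart lowers `f` by a fixed
`δ`. A potential combining `f`, `log L` and `k` drops by 1 per iteration yet is bounded below: a
contradiction. -/

namespace RestartedAGD

/-! ### Descent estimates for Lipschitz gradients -/

section Analysis

variable {E : Type*} [NormedAddCommGroup E] [InnerProductSpace ℝ E] [CompleteSpace E]

/-- A function with `C`-Lipschitz gradient differs from its linearization by at most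
`C / 2 * ‖v - u‖ ^ 2`. -/
theorem abs_sub_linearization_le {f : E → ℝ} (hf : Differentiable ℝ f) {C : ℝ}
    (hgrad : ∀ u v, ‖gradient f u - gradient f v‖ ≤ C * ‖u - v‖) (u v : E) :
    |f v - f u - inner ℝ (gradient f u) (v - u)| ≤ C / 2 * ‖v - u‖ ^ 2 := by
  set w := v - u with hw
  have hφ : ∀ t : ℝ, HasDerivAt (fun t : ℝ => f (u + t • w) - f u - t * inner ℝ (gradient f u) w)
      (inner ℝ (gradient f (u + t • w) - gradient f u) w) t := by
    intro t
    have h1 : HasDerivAt (fun t : ℝ => u + t • w) w t := by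
      simpa using ((hasDerivAt_id t).smul_const w).const_add u
    have h2 : HasDerivAt (fun t : ℝ => f (u + t • w)) (inner ℝ (gradient f (u + t • w)) w) t := by
      have h := ((hf (u + t • w)).hasGradientAt.hasFDerivAt).comp_hasDerivAt t h1
      simpa [Function.comp_def] using h
    have h3 := (h2.sub_const (f u)).sub
      ((hasDerivAt_id t).mul_const (inner ℝ (gradient f u) w))
    rw [inner_sub_left]
    simpa [Pi.sub_def] using h3
  have hB : ∀ t : ℝ, HasDerivAt (fun t : ℝ => C / 2 * ‖w‖ ^ 2 * t ^ 2) (C * ‖w‖ ^ 2 * t) t := by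
    intro t
    refine ((hasDerivAt_pow 2 t).const_mul (C / 2 * ‖w‖ ^ 2)).congr_deriv ?_
    norm_num
    ring
  have key := image_norm_le_of_norm_deriv_right_le_deriv_boundary (a := 0) (b := 1)
    (fun t _ => (hφ t).continuousAt.continuousWithinAt)
    (fun t _ => (hφ t).hasDerivWithinAt) (by simp) hB
    (by
      intro t ht
      have h1 := hgrad (u + t • w) u
      rw [add_sub_cancel_left, norm_smul, Real.norm_eq_abs, abs_of_nonneg ht.1] at h1
      calc ‖inner ℝ (gradient f (u + t • w) - gradient f u) w‖
          ≤ ‖gradient f (u + t • w) - gradient f u‖ * ‖w‖ := norm_inner_le_norm _ _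
        _ ≤ C * (t * ‖w‖) * ‖w‖ := by gcongr
        _ = C * ‖w‖ ^ 2 * t := by ring)
    (Set.right_mem_Icc.mpr zero_le_one)
  simpa [hw, Real.norm_eq_abs] using key

/-- One step of the method: energy estimate with momentum `d` and factor `θ`. -/
theorem energy_step {f : E → ℝ} (hf : Differentiable ℝ f) {C L : ℝ}
    (hgrad : ∀ u v, ‖gradient f u - gradient f v‖ ≤ C * ‖u - v‖) (hL : 0 < L) (hCL : C ≤ L)
    (u d : E) (θ : ℝ) :
    f (u + θ • d - (1 / L) • gradient f (u + θ • d))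
        + L / 2 * ‖u + θ • d - (1 / L) • gradient f (u + θ • d) - u‖ ^ 2
      ≤ f u + (L + C) / 2 * θ ^ 2 * ‖d‖ ^ 2 := by
  set p := u + θ • d with hp
  set g := gradient f p with hg
  -- Both endpoints are compared with the linearization at `p`; the `⟪g, d⟫` terms then cancel
  -- against the expanded square, and `C ≤ L` absorbs the `‖g‖²` terms.
  have h1 := (abs_le.mp (abs_sub_linearization_le hf hgrad p (p - (1 / L) • g))).2
  have h2 := (abs_le.mp (abs_sub_linearization_le hf hgrad p u)).1
  have e1 : p - (1 / L) • g - p = -((1 / L) • g) := by abel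
  have e2 : u - p = -(θ • d) := by rw [hp]; abel
  have e3 : p - (1 / L) • g - u = θ • d - (1 / L) • g := by rw [hp]; abel
  rw [e1, ← hg, inner_neg_right, norm_neg, inner_smul_right, real_inner_self_eq_norm_sq,
    norm_smul, mul_pow, Real.norm_eq_abs, sq_abs] at h1
  rw [e2, ← hg, inner_neg_right, norm_neg, inner_smul_right, norm_smul, mul_pow,
    Real.norm_eq_abs, sq_abs] at h2
  rw [e3, norm_sub_sq_real, inner_smul_left, inner_smul_right, norm_smul, norm_smul, mul_pow,
    mul_pow, Real.norm_eq_abs, Real.norm_eq_abs, sq_abs, sq_abs, real_inner_comm]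
  have e4 : L / 2 * (θ ^ 2 * ‖d‖ ^ 2 - 2 * (θ * (1 / L * inner ℝ g d)) + (1 / L) ^ 2 * ‖g‖ ^ 2)
      = L / 2 * θ ^ 2 * ‖d‖ ^ 2 - θ * inner ℝ g d + 1 / L * ‖g‖ ^ 2 / 2 := by
    field_simp
  have e5 : C / 2 * ((1 / L) ^ 2 * ‖g‖ ^ 2) ≤ 1 / L * ‖g‖ ^ 2 / 2 := by
    calc C / 2 * ((1 / L) ^ 2 * ‖g‖ ^ 2) ≤ L / 2 * ((1 / L) ^ 2 * ‖g‖ ^ 2) := by gcongr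
      _ = 1 / L * ‖g‖ ^ 2 / 2 := by field_simp
  simp only [conj_trivial]
  rw [e4]
  linarith

end Analysis

/-! ### Energy within one epoch -/

section Epoch

variable {E : Type*} [NormedAddCommGroup E] [InnerProductSpace ℝ E] [CompleteSpace E]
  (f : E → ℝ) (x₀ : E) (L : ℝ)

theorem x_zero : x f x₀ L 0 = x₀ := rfl

theorem x_succ (k : ℕ) :
    x f x₀ L (k + 1) = y f x₀ L k - (1 / L) • gradient f (y f x₀ L k) := rfl

theorem y_zero : y f x₀ L 0 = x₀ := rfl

theorem y_eq (k : ℕ) :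
    y f x₀ L k = x f x₀ L k + theta k • (x f x₀ L k - x f x₀ L (k - 1)) := by
  cases k with
  | zero => simp [x_zero, y_zero]
  | succ k => rfl

theorem S_succ (k : ℕ) :
    S f x₀ L (k + 1) = S f x₀ L k + ‖x f x₀ L (k + 1) - x f x₀ L k‖ ^ 2 :=
  Finset.sum_range_succ _ _

theorem S_mono : Monotone (S f x₀ L) := by
  refine monotone_nat_of_le_succ fun k => ?_
  rw [S_succ]
  exact le_add_of_nonneg_right (sq_nonneg _)

theorem S_one : S f x₀ L 1 = ‖gradient f x₀‖ ^ 2 / L ^ 2 := by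
  rw [S, Finset.sum_range_one, x_succ, x_zero, y_zero, sub_sub_cancel_left, norm_neg, norm_smul,
    mul_pow, Real.norm_eq_abs, sq_abs]
  ring

theorem ybar_one : ybar f x₀ L 1 = x₀ := by
  have h : Finset.Ioo 0 1 = (∅ : Finset ℕ) := rfl
  simp [ybar, weight, Z, y_zero, h]

theorem le_M (rule : Rule) (M₀ : ℝ) (k : ℕ) : M₀ ≤ M rule f x₀ L M₀ k := by
  induction k with
  | zero => exact le_rfl
  | succ k ih =>
    have h : M rule f x₀ L M₀ k ≤ M rule f x₀ L M₀ (k + 1) := by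
      cases rule with
      | basic => exact le_max_left _ _
      | averaged => exact (le_max_left _ _).trans (le_max_left _ _)
    exact ih.trans h

variable {f L}

/-- The condition `k C ≤ L` is exactly `(L + C) θ_k ≤ L`, so the incoming kinetic term of
`energy_step` is paid for by the energy. The unused fraction `1 - θ_{k+1} = 1/(k+2)` of each new
kinetic term accumulates in the sum. -/
theorem energy_le (hf : Differentiable ℝ f) {C : ℝ} (hC : 0 < C)
    (hgrad : ∀ u v, ‖gradient f u - gradient f v‖ ≤ C * ‖u - v‖) (hCL : C ≤ L) (k : ℕ)
    (hk : k * C ≤ L) :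
    f (x f x₀ L k) + L / 2 * theta k * ‖x f x₀ L k - x f x₀ L (k - 1)‖ ^ 2
      + L / 2 * ∑ i ∈ Finset.range k, ‖x f x₀ L (i + 1) - x f x₀ L i‖ ^ 2 / (i + 2) ≤ f x₀ := by
  have hL : 0 < L := hC.trans_le hCL
  induction k with
  | zero => simp [x_zero, theta]
  | succ k ih =>
    have hk' : (k : ℝ) * C ≤ L := by
      push_cast at hk
      linarith
    have h1 := ih hk'
    have h2 := energy_step hf hgrad hL hCL (x f x₀ L k) (x f x₀ L k - x f x₀ L (k - 1)) (theta k)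
    rw [← y_eq, ← x_succ] at h2
    have h3 : (L + C) / 2 * theta k ^ 2 ≤ L / 2 * theta k := by
      have hk1 : (0 : ℝ) < (k : ℝ) + 1 := by positivity
      have h4 : (L + C) * theta k ≤ L := by
        rw [theta, mul_div_assoc', div_le_iff₀ hk1]
        linarith
      have h5 : 0 ≤ theta k := by
        unfold theta
        positivity
      calc (L + C) / 2 * theta k ^ 2 = (L + C) * theta k * theta k / 2 := by ring
        _ ≤ L * theta k / 2 := by gcongr
        _ = L / 2 * theta k := by ring
    have h6 := mul_le_mul_of_nonneg_right h3 (sq_nonneg ‖x f x₀ L k - x f x₀ L (k - 1)‖)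
    have h7 : theta (k + 1) = 1 - 1 / (k + 2) := by
      rw [theta]
      push_cast
      field_simp
      ring
    rw [Finset.sum_range_succ, Nat.add_sub_cancel, h7]
    have h8 : L / 2 * (1 - 1 / ((k : ℝ) + 2)) * ‖x f x₀ L (k + 1) - x f x₀ L k‖ ^ 2
        + L / 2 * (‖x f x₀ L (k + 1) - x f x₀ L k‖ ^ 2 / (k + 2))
        = L / 2 * ‖x f x₀ L (k + 1) - x f x₀ L k‖ ^ 2 := by ring
    linarith

/-- Sufficient decrease within an epoch that is short compared to `L`. -/
theorem sufficient_decrease (hf : Differentiable ℝ f) {C : ℝ} (hC : 0 < C)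
    (hgrad : ∀ u v, ‖gradient f u - gradient f v‖ ≤ C * ‖u - v‖) (hCL : C ≤ L) (k : ℕ)
    (hk : k * C ≤ L) :
    f (x f x₀ L k) ≤ f x₀ - L * S f x₀ L k / (2 * ((k : ℝ) + 1)) := by
  have hL : 0 < L := hC.trans_le hCL
  have h1 := energy_le x₀ hf hC hgrad hCL k hk
  have h2 : S f x₀ L k / (k + 1)
      ≤ ∑ i ∈ Finset.range k, ‖x f x₀ L (i + 1) - x f x₀ L i‖ ^ 2 / ((i : ℝ) + 2) := by
    rw [S, Finset.sum_div]
    refine Finset.sum_le_sum fun i hi => ?_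
    have h3 : (i : ℝ) + 1 ≤ k := by exact_mod_cast Finset.mem_range.mp hi
    exact div_le_div_of_nonneg_left (sq_nonneg _) (by positivity) (by linarith)
  have h4 : 0 ≤ L / 2 * theta k * ‖x f x₀ L k - x f x₀ L (k - 1)‖ ^ 2 := by
    unfold theta
    positivity
  have h5 := mul_le_mul_of_nonneg_left h2 (half_pos hL).le
  have h6 : L * S f x₀ L k / (2 * ((k : ℝ) + 1)) = L / 2 * (S f x₀ L k / (k + 1)) := by
    field_simp
  linarith

theorem le_S_of_le_norm_gradient {ε : ℝ} (hε : 0 < ε) (hx₀ : ε ≤ ‖gradient f x₀‖) {k : ℕ}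
    (hk : 1 ≤ k) : ε ^ 2 / L ^ 2 ≤ S f x₀ L k := by
  refine le_trans ?_ (S_mono f x₀ L hk)
  rw [S_one]
  gcongr

end Epoch

/-! ### Invariant and potential along the run -/

section Run

variable {E : Type*} [NormedAddCommGroup E] [InnerProductSpace ℝ E] [CompleteSpace E]

/-- The properties of the states of a run all of whose epochs start at points with gradient of norm
at least `ε`. -/
structure Invariant (f : E → ℝ) (M₀ ε B : ℝ) (s : State E) : Prop where
  L_pos : 0 < s.L
  L_le : s.L ≤ B
  decrease : f (x f s.x₀ s.L s.k) ≤ f s.x₀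
  short : s.k ≠ 0 → ((s.k : ℝ) + 1) ^ 5 * (M₀ * ε) ^ 2 ≤ s.L ^ 4

variable {f : E → ℝ} {M₀ ε B α β : ℝ} {s : State E}

theorem Invariant.k_le (h : Invariant f M₀ ε B s) (hM₀ : 0 < M₀) (hε : 0 < ε) :
    (s.k : ℝ) ≤ B ^ 4 / (M₀ * ε) ^ 2 := by
  by_cases hk : s.k = 0
  · rw [hk]
    push_cast
    positivity
  · have h1 := h.short hk
    have h2 : s.L ^ 4 ≤ B ^ 4 := pow_le_pow_left₀ h.L_pos.le h.L_le 4
    rw [le_div_iff₀ (by positivity)]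
    refine le_trans ?_ (h1.trans h2)
    gcongr
    have h3 : (1 : ℝ) ≤ (s.k : ℝ) + 1 := by simp
    exact (le_add_of_nonneg_right zero_le_one).trans (le_self_pow₀ h3 (by norm_num))

/-- A restart with increased `L` only happens while `L` is below a fixed threshold. -/
theorem Invariant.sufficient_decrease_of_threshold_le (h : Invariant f M₀ ε B s) {C : ℝ}
    (hf : Differentiable ℝ f) (hC : 0 < C)
    (hgrad : ∀ u v, ‖gradient f u - gradient f v‖ ≤ C * ‖u - v‖) (hM₀ : 0 < M₀) (hε : 0 < ε)
    (hCL : C ≤ s.L) (hthr : C ^ 5 / (M₀ * ε) ^ 2 ≤ s.L) :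
    f (x f s.x₀ s.L (s.k + 1))
      ≤ f s.x₀ - s.L * S f s.x₀ s.L (s.k + 1) / (2 * (((s.k + 1 : ℕ) : ℝ) + 1)) := by
  refine sufficient_decrease s.x₀ hf hC hgrad hCL (s.k + 1) ?_
  by_cases hk : s.k = 0
  · simpa [hk] using hCL
  · have h1 := h.short hk
    push_cast
    have hL := h.L_pos
    rw [div_le_iff₀ (by positivity)] at hthr
    -- Fifth powers: multiply `(k+1)⁵(M₀ε)² ≤ L⁴` by `C⁵ ≤ L(M₀ε)²`.
    refine le_of_pow_le_pow_left₀ (n := 5) (by norm_num) hL.le ?_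
    have h2 : (((s.k : ℝ) + 1) * C) ^ 5 * (M₀ * ε) ^ 2 ≤ s.L ^ 5 * (M₀ * ε) ^ 2 := by
      calc (((s.k : ℝ) + 1) * C) ^ 5 * (M₀ * ε) ^ 2
          = ((s.k : ℝ) + 1) ^ 5 * (M₀ * ε) ^ 2 * C ^ 5 := by ring
        _ ≤ s.L ^ 4 * (s.L * (M₀ * ε) ^ 2) := by gcongr
        _ = s.L ^ 5 * (M₀ * ε) ^ 2 := by ring
    exact le_of_mul_le_mul_right h2 (by positivity)

/-- The invariant is preserved, and every iteration either continues the epoch, or increases `L`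
without increasing the objective, or decreases the objective by a fixed amount. -/
theorem Invariant.step (h : Invariant f M₀ ε B s) {C : ℝ} (rule : Rule)
    (hf : Differentiable ℝ f) (hC : 0 < C)
    (hgrad : ∀ u v, ‖gradient f u - gradient f v‖ ≤ C * ‖u - v‖) (hM₀ : 0 < M₀) (hε : 0 < ε)
    (hα : 1 < α) (hβ_pos : 0 < β) (hβ_le : β ≤ 1)
    (hB : α * max C (C ^ 5 / (M₀ * ε) ^ 2) ≤ B) (hx₀ : ε ≤ ‖gradient f s.x₀‖) :
    Invariant f M₀ ε B (step rule f M₀ α β s) ∧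
      ((∃ x', f x' ≤ f s.x₀ ∧ step rule f M₀ α β s = ⟨x', α * s.L, 0⟩) ∨
        (∃ x', f x' ≤ f s.x₀ - ε ^ 2 / (2 * B * (B ^ 4 / (M₀ * ε) ^ 2 + 2)) ∧
          step rule f M₀ α β s = ⟨x', β * s.L, 0⟩) ∨
        step rule f M₀ α β s = ⟨s.x₀, s.L, s.k + 1⟩) := by
  have hL := h.L_pos
  have hα0 : 0 < α := zero_lt_one.trans hα
  have hS := le_S_of_le_norm_gradient (L := s.L) s.x₀ hε hx₀ (Nat.le_add_left 1 s.k)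
  have hM := le_M f s.x₀ s.L rule M₀ (s.k + 1)
  have hS0 : 0 ≤ S f s.x₀ s.L (s.k + 1) := le_trans (by positivity) hS
  unfold RestartedAGD.step
  simp only [Nat.add_sub_cancel]
  split_ifs with h1 h2
  · have hlt : s.L < max C (C ^ 5 / (M₀ * ε) ^ 2) := by
      by_contra! hle
      exact absurd (h.sufficient_decrease_of_threshold_le hf hC hgrad hM₀ hε
        ((le_max_left _ _).trans hle) ((le_max_right _ _).trans hle)) (not_le.mpr h1)
    refine ⟨⟨by positivity, ?_, le_of_eq rfl, fun hk => absurd rfl hk⟩,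
      Or.inl ⟨_, h.decrease, rfl⟩⟩
    exact (mul_le_mul_of_nonneg_left hlt.le hα0.le).trans hB
  · refine ⟨⟨by positivity, ?_, le_of_eq rfl, fun hk => absurd rfl hk⟩,
      Or.inr (Or.inl ⟨_, ?_, rfl⟩)⟩
    · exact (mul_le_of_le_one_left hL.le hβ_le).trans h.L_le
    · have hk := h.k_le hM₀ hε
      have hLB := h.L_le
      have hB0 : 0 < B := hL.trans_le hLB
      refine (not_lt.mp h1).trans (sub_le_sub_left ?_ _)
      push_cast
      calc ε ^ 2 / (2 * B * (B ^ 4 / (M₀ * ε) ^ 2 + 2))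
          ≤ ε ^ 2 / (2 * s.L * ((s.k : ℝ) + 2)) := by gcongr
        _ = s.L * (ε ^ 2 / s.L ^ 2) / (2 * ((s.k : ℝ) + 1 + 1)) := by
            field_simp
            ring
        _ ≤ s.L * S f s.x₀ s.L (s.k + 1) / (2 * ((s.k : ℝ) + 1 + 1)) := by gcongr
  · refine ⟨⟨hL, h.L_le, ?_, fun _ => ?_⟩, Or.inr (Or.inr rfl)⟩
    · refine (not_lt.mp h1).trans (sub_le_self _ ?_)
      positivity
    -- The failed second test, with `M_k ≥ M₀` and `S_k ≥ ε²/L²`, yields `short` for the new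
    -- counter.
    · have h3 := not_lt.mp h2
      have h4 : (((s.k + 1 : ℕ) : ℝ) + 1) ^ 5 * M₀ ^ 2 * (ε ^ 2 / s.L ^ 2) ≤ s.L ^ 2 := by
        refine le_trans ?_ h3
        gcongr
      rw [mul_div_assoc', div_le_iff₀ (by positivity)] at h4
      calc (((s.k + 1 : ℕ) : ℝ) + 1) ^ 5 * (M₀ * ε) ^ 2
          = (((s.k + 1 : ℕ) : ℝ) + 1) ^ 5 * M₀ ^ 2 * ε ^ 2 := by ring
        _ ≤ s.L ^ 2 * s.L ^ 2 := h4
        _ = s.L ^ 4 := by ring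

/-- The first iteration of an epoch outputs `ȳ_1 = x_0`; while the epoch continues, its start does
not change. -/
theorem norm_gradient_epoch_start (rule : Rule) (xinit : E) (Linit : ℝ)
    (hz : ∀ K, 1 ≤ K → ε ≤ ‖gradient f (z rule f xinit Linit M₀ α β K)‖) (K : ℕ) :
    ε ≤ ‖gradient f (state rule f xinit Linit M₀ α β K).x₀‖ := by
  induction K with
  | zero =>
    have h := hz 1 le_rfl
    simpa [z, state, ybar_one] using h
  | succ K ih =>
    by_cases hk : (state rule f xinit Linit M₀ α β (K + 1)).k = 0
    · have h := hz (K + 2) (by omega)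
      simp only [z, show K + 2 - 1 = K + 1 from rfl] at h
      rwa [hk, ybar_one] at h
    · have hs : (state rule f xinit Linit M₀ α β (K + 1)).x₀
          = (state rule f xinit Linit M₀ α β K).x₀ := by
        simp only [state, RestartedAGD.step] at hk ⊢
        split_ifs at hk ⊢ <;> first | rfl | exact absurd rfl hk
      rwa [hs]

/-- The averaged solutions cannot all have gradients bounded away from zero. -/
theorem exists_norm_gradient_z_lt (rule : Rule) (hf : Differentiable ℝ f)
    (hf_bdd : BddBelow (Set.range f)) {C : ℝ} (hC : 0 < C)
    (hgrad : ∀ u v, ‖gradient f u - gradient f v‖ ≤ C * ‖u - v‖)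
    (xinit : E) {Linit : ℝ} (hLinit : 0 < Linit) (hM₀ : 0 < M₀) (hα : 1 < α) (hβ_pos : 0 < β)
    (hβ_le : β ≤ 1) (hε : 0 < ε) :
    ∃ K, 1 ≤ K ∧ ‖gradient f (z rule f xinit Linit M₀ α β K)‖ < ε := by
  by_contra! hz
  have hx₀ := norm_gradient_epoch_start rule xinit Linit hz
  obtain ⟨m, hm⟩ := hf_bdd
  have hm' : ∀ u, m ≤ f u := fun u => hm ⟨u, rfl⟩
  set B := max Linit (α * max C (C ^ 5 / (M₀ * ε) ^ 2)) with hBdef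
  have hB : 0 < B := lt_max_of_lt_left hLinit
  set N := B ^ 4 / (M₀ * ε) ^ 2 with hN
  have hN0 : 0 ≤ N := by positivity
  set δ := ε ^ 2 / (2 * B * (N + 2)) with hδ
  have hδ0 : 0 < δ := by positivity
  have hlogα : 0 < Real.log α := Real.log_pos hα
  have hlogβ : Real.log β ≤ 0 := Real.log_nonpos hβ_pos.le hβ_le
  -- Resetting `k` raises `-k` by at most `N`. The weight `b` makes an `α`-restart gain `N + 1` from
  -- `log L`; `a` makes a `β`-restart gain `N + 1` from `f` after paying `-b log β`.
  set b := (N + 1) / Real.log α with hb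
  have hb0 : 0 < b := by positivity
  set a := (N + 1 - b * Real.log β) / δ with ha
  have ha0 : 0 ≤ a := div_nonneg (by nlinarith) hδ0.le
  have hbα : b * Real.log α = N + 1 := div_mul_cancel₀ _ hlogα.ne'
  have haδ : a * δ = N + 1 - b * Real.log β := div_mul_cancel₀ _ hδ0.ne'
  let st := state rule f xinit Linit M₀ α β
  let V : State E → ℝ := fun s => a * f s.x₀ - b * Real.log s.L - s.k
  have key : ∀ K : ℕ, Invariant f M₀ ε B (st K) ∧ V (st K) ≤ V (st 0) - K := by
    intro K
    induction K with
    | zero =>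
      exact ⟨⟨hLinit, le_max_left _ _, le_of_eq rfl, fun hk => absurd rfl hk⟩, by simp⟩
    | succ K ih =>
      obtain ⟨hinv, hV⟩ := ih
      obtain ⟨hinv', hcase⟩ := hinv.step rule hf hC hgrad hM₀ hε hα hβ_pos hβ_le
        (le_max_right _ _) (hx₀ K)
      refine ⟨hinv', ?_⟩
      have hk := hinv.k_le hM₀ hε
      have hL := hinv.L_pos
      suffices hdec : V (step rule f M₀ α β (st K)) ≤ V (st K) - 1 by
        have hst : st (K + 1) = step rule f M₀ α β (st K) := rfl
        rw [hst]
        push_cast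
        linarith
      rcases hcase with ⟨x', hx', hs⟩ | ⟨x', hx', hs⟩ | hs
      · rw [hs]
        simp only [V]
        rw [Real.log_mul (by positivity) hL.ne']
        have := mul_le_mul_of_nonneg_left hx' ha0
        push_cast
        linarith
      · rw [hs]
        simp only [V]
        rw [Real.log_mul hβ_pos.ne' hL.ne']
        have := mul_le_mul_of_nonneg_left hx' ha0
        rw [mul_sub, haδ] at this
        push_cast
        linarith
      · rw [hs]
        simp only [V]
        push_cast
        linarith
  -- The lower bound on `V` uses `f ≥ m`, `L ≤ B`, `k ≤ N`; no positive lower bound on `L` is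
  -- needed, as `log L` enters with a minus sign.
  obtain ⟨K, hK⟩ := exists_nat_gt (V (st 0) - (a * m - b * Real.log B - N))
  obtain ⟨hinv, hV⟩ := key K
  have h1 := mul_le_mul_of_nonneg_left (hm' (st K).x₀) ha0
  have h2 := mul_le_mul_of_nonneg_left (Real.log_le_log hinv.L_pos hinv.L_le) hb0.le
  have h3 := hinv.k_le hM₀ hε
  have h4 : V (st K) = a * f (st K).x₀ - b * Real.log (st K).L - (st K).k := rfl
  linarith

end Run

end RestartedAGD

theorem mainTheorem2 (d : ℕ) (f : EuclideanSpace ℝ (Fin d) → ℝ)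
    (hf_diff : Differentiable ℝ f) (hf_diff₂ : Differentiable ℝ (gradient f))
    (hf_bdd : BddBelow (Set.range f))
    (Lf Mf : ℝ) (hLf : 0 < Lf) (hMf : 0 < Mf)
    (hf_grad : ∀ u v, ‖gradient f u - gradient f v‖ ≤ Lf * ‖u - v‖)
    (hf_hess : ∀ u v,
      ‖RestartedAGD.hessian f u - RestartedAGD.hessian f v‖ ≤ Mf * ‖u - v‖)
    (rule : RestartedAGD.Rule) (xinit : EuclideanSpace ℝ (Fin d))
    (Linit M₀ α β : ℝ) (hLinit : 0 < Linit) (hM₀ : 0 < M₀)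
    (hα : 1 < α) (hβ_pos : 0 < β) (hβ_le : β ≤ 1) :
    Filter.Tendsto
      (fun K : ℕ => (Finset.Icc 1 (K + 1)).inf'
        (Finset.nonempty_Icc.mpr (Nat.le_add_left 1 K))
        (fun i => ‖gradient f (RestartedAGD.z rule f xinit Linit M₀ α β i)‖))
      Filter.atTop (nhds 0) := by
  rw [Metric.tendsto_atTop]
  intro ε hε
  obtain ⟨K, hK1, hK⟩ := RestartedAGD.exists_norm_gradient_z_lt rule hf_diff hf_bdd hLf hf_grad
    xinit hLinit hM₀ hα hβ_pos hβ_le hε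
  refine ⟨K, fun n hn => ?_⟩
  rw [Real.dist_0_eq_abs, abs_of_nonneg (Finset.le_inf' _ _ fun i _ => norm_nonneg _)]
  exact (Finset.inf'_le _ (Finset.mem_Icc.mpr ⟨hK1, by omega⟩)).trans_lt hK
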